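/- Let $E$ be a Hausdorff real topological vector space (which need not be locally convex) and let $U\subseteq E$ be a subset, endowed with the topology induced by $E$, such that $U$ is open in $E$, or $U$ is semi-locally convex, i.e., each $p\in U$ has a neighbourhood relative to $U$ which is a convex subset of $E$. Let $E_\infty$ be a vector subspace of $E$ such that $U_\infty:=U\cap E_\infty$ is dense in $U$. Endow $E_\infty$ with the finite topology, i.e., the final topology with respect to the inclusion maps $F\to E_\infty$ of all finite-dimensional vector subspaces $F\subseteq E_\infty$ (each $F$ carrying its unique Hausdorff vector space topology, which is the one induced by $E$), and endow $U_\infty$ with the topology $\mathcal O$ induced by the finite topology on $E_\infty$. Then the inclusion map $(U_\infty,\mathcal O)\to U$ is a weak homotopy equivalence: it is continuous, it induces a bijection between the sets of path components, and it induces bijections $\pi_k(U_\infty,p)\to\pi_k(U,p)$ for all $k\in\mathbb N_0$ and $p\in U_\infty$. Furthermore, for all $k\in\mathbb N_0$ and $p\in U_\infty$, $$\pi_k(U,p)=\varinjlim_{F\in\mathcal F_p}\pi_k(U\cap F,p),$$ where $\mathcal F_p$ is the set of all finite-dimensional vector subspaces $F\subseteq E_\infty$ with $p\in F$, directed by inclusion,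 and $U\cap F$ carries the topology induced by $E$. That is, the canonical map from the direct limit to $\pi_k(U,p)$ induced by the inclusions $U\cap F\to U$ is a bijection if $k=0$ (direct limit in the category of sets) and an isomorphism of groups if $k\ge 1$ (direct limit in the category of groups). -/

import Mathlib

open scoped Topology unitInterval

noncomputable section

namespace PalaisFinite

/-! ### Maps induced on homotopy groups and path components -/

section Induced

variable {X Y Z : Type*} [TopologicalSpace X] [TopologicalSpace Y] [TopologicalSpace Z]

/-- Post-composition of a generalized loop based at `x` with a continuous map taking `x` to `y`. -/
def genLoopMap {N : Type*} (f : C(X, Y)) {x : X} {y : Y} (h : f x = y)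
    (γ : GenLoop N X x) : GenLoop N Y y :=
  ⟨f.comp γ.1, fun t ht => by
    rw [ContinuousMap.comp_apply, γ.2 t ht, h]⟩

/-- The map `f_* : π_k(X, x) → π_k(Y, y)`, `[γ] ↦ [f ∘ γ]`, induced by a continuous map `f`
with `f x = y`. -/
def piMap (k : ℕ) (f : C(X, Y)) {x : X} {y : Y} (h : f x = y) : π_ k X x → π_ k Y y :=
  Quotient.map (genLoopMap f h) fun _ _ hab => ContinuousMap.HomotopicRel.comp_continuousMap hab f

theorem piMap_mk (k : ℕ) (f : C(X, Y)) {x : X} {y : Y} (h : f x = y)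
    (γ : GenLoop (Fin k) X x) :
    piMap k f h (Quotient.mk _ γ) = Quotient.mk _ (genLoopMap f h γ) := rfl

theorem piMap_id (k : ℕ) {x : X} (f : C(X, X)) (hf : ∀ z, f z = z) (h : f x = x) (a : π_ k X x) :
    piMap k f h a = a := by
  induction a using Quotient.inductionOn with
  | h γ =>
    rw [piMap_mk]
    congr 1
    ext t
    exact hf _

theorem piMap_comp (k : ℕ) (g : C(Y, Z)) (f : C(X, Y)) (e : C(X, Z)) (he : ∀ z, g (f z) = e z)
    {x : X} {y : Y} {z : Z} (hf : f x = y) (hg : g y = z) (h : e x = z) (a : π_ k X x) :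
    piMap k g hg (piMap k f hf a) = piMap k e h a := by
  induction a using Quotient.inductionOn with
  | h γ =>
    rw [piMap_mk, piMap_mk, piMap_mk]
    congr 1
    ext t
    exact he _

/-- For `k + 1 ≥ 1`, the induced map `f_*` as a homomorphism of groups. -/
def piHom (k : ℕ) (f : C(X, Y)) {x : X} {y : Y} (h : f x = y) :
    π_ (k + 1) X x →* π_ (k + 1) Y y :=
  MonoidHom.mk' (piMap (k + 1) f h) fun a b => by
    induction a using Quotient.inductionOn with
    | h p =>
      induction b using Quotient.inductionOn with
      | h q =>
        refine (congrArg (piMap (k + 1) f h)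
          (HomotopyGroup.mul_spec (i := (0 : Fin (k + 1))) (p := p) (q := q))).trans ?_
        refine Eq.trans ?_ (HomotopyGroup.mul_spec (i := (0 : Fin (k + 1)))
          (p := genLoopMap f h p) (q := genLoopMap f h q)).symm
        refine congrArg (Quotient.mk _) ?_
        ext t
        change f (GenLoop.transAt 0 q p t) = _
        simp only [GenLoop.transAt, GenLoop.coe_copy]
        split_ifs <;> rfl

theorem piHom_apply (k : ℕ) (f : C(X, Y)) {x : X} {y : Y} (h : f x = y) (a : π_ (k + 1) X x) :
    piHom k f h a = piMap (k + 1) f h a := rfl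

/-- The map induced by a continuous map between sets of path components. -/
def pathComponentsMap (f : C(X, Y)) : ZerothHomotopy X → ZerothHomotopy Y :=
  Quotient.map f fun _ _ hab => hab.map f.continuous

/-- A weak homotopy equivalence: a continuous map which induces a bijection between the sets of
path components and bijections on all homotopy groups, for all base points. -/
def IsWeakHomotopyEquiv (f : C(X, Y)) : Prop :=
  Function.Bijective (pathComponentsMap f) ∧
    ∀ (k : ℕ) (x : X), Function.Bijective (piMap k f (rfl : f x = f x))

end Induced

/-! ### Finite-dimensional vector subspaces -/

variable {E : Type*} [AddCommGroup E] [Module ℝ E]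

/-- The finite-dimensional vector subspaces of `E` contained in `V`. -/
abbrev FinSub (V : Submodule ℝ E) : Type _ :=
  {F : Submodule ℝ E // F ≤ V ∧ FiniteDimensional ℝ F}

/-- The set `ℱ_p` of the finite-dimensional vector subspaces `F ⊆ V` with `p ∈ F`, ordered by
inclusion. -/
abbrev FinSubAt (V : Submodule ℝ E) (p : E) : Type _ :=
  {F : Submodule ℝ E // F ≤ V ∧ FiniteDimensional ℝ F ∧ p ∈ F}

instance (V : Submodule ℝ E) (p : E) : IsDirectedOrder (FinSubAt V p) where
  directed F G := by
    obtain ⟨F, hF, hF', hpF⟩ := F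
    obtain ⟨G, hG, hG', hpG⟩ := G
    exact ⟨⟨F ⊔ G, sup_le hF hG, inferInstance, (le_sup_left : F ≤ F ⊔ G) hpF⟩,
      (le_sup_left : F ≤ F ⊔ G), (le_sup_right : G ≤ F ⊔ G)⟩

theorem finSubAt_nonempty {V : Submodule ℝ E} {p : E} (hp : p ∈ V) : Nonempty (FinSubAt V p) :=
  ⟨⟨Submodule.span ℝ {p}, by simpa using hp, inferInstance, Submodule.mem_span_singleton_self p⟩⟩

variable [TopologicalSpace E]

/-- `U` is semi-locally convex: each `p ∈ U` has a neighbourhood relative to `U` which is a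
convex subset of `E`. -/
def IsSemiLocallyConvex (U : Set E) : Prop :=
  ∀ p ∈ U, ∃ W ⊆ U, W ∈ 𝓝[U] p ∧ Convex ℝ W

/-! ### The finite topology -/

/-- The vector subspace `V` as a set of points, to be endowed with the finite topology (and not
with the topology induced by `E`). -/
def WithFiniteTopology (V : Submodule ℝ E) : Type _ := V

/-- The inclusion `F → V` of a finite-dimensional vector subspace. -/
def toWithFiniteTopology (V : Submodule ℝ E) (F : FinSub V) : F.1 → WithFiniteTopology V :=
  Submodule.inclusion F.2.1

/-- The finite topology: the final topology with respect to the inclusions `F → V` of the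
finite-dimensional vector subspaces `F ⊆ V`, each with the topology induced by `E` (which, `E`
being Hausdorff, is the unique Hausdorff vector space topology on `F`). -/
instance (V : Submodule ℝ E) : TopologicalSpace (WithFiniteTopology V) :=
  ⨆ F : FinSub V, TopologicalSpace.coinduced (toWithFiniteTopology V F) inferInstance

/-- The inclusion of `V`, with its finite topology, into `E`. -/
def WithFiniteTopology.incl (V : Submodule ℝ E) : C(WithFiniteTopology V, E) where
  toFun x := Submodule.subtype V x
  continuous_toFun := by
    refine continuous_iSup_dom.2 fun F => continuous_coinduced_dom.2 ?_
    exact continuous_subtype_val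

/-- `U_∞ = U ∩ V`, with the topology induced by the finite topology on `V`. -/
abbrev UInfty (U : Set E) (V : Submodule ℝ E) : Type _ :=
  {x : WithFiniteTopology V // WithFiniteTopology.incl V x ∈ U}

/-- The inclusion `U_∞ → U`, where `U` has the topology induced by `E`. -/
def UInfty.incl (U : Set E) (V : Submodule ℝ E) : C(UInfty U V, U) where
  toFun x := ⟨WithFiniteTopology.incl V x.1, x.2⟩
  continuous_toFun := by fun_prop

/-! ### The direct limit of the homotopy groups `π_k(U ∩ F, p)` -/

section Limit

variable {U : Set E} {V : Submodule ℝ E} {p : E}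

/-- Plain maps of sets as the morphisms of a direct system of sets. -/
@[reducible]
def funLikeFun (α β : Type*) : FunLike (α → β) α β := ⟨id, Function.injective_id⟩

attribute [local instance] funLikeFun

/-- The slice `U ∩ F`, with the topology induced by `E`. -/
abbrev Slice (U : Set E) (F : Submodule ℝ E) : Type _ := ↥(U ∩ (F : Set E))

/-- The point `p` as an element of the slice `U ∩ F`, for `F ∈ ℱ_p`. -/
abbrev slicePt (hU : p ∈ U) (F : FinSubAt V p) : Slice U F.1 := ⟨p, hU, F.2.2.2⟩

/-- The inclusion `U ∩ F → U ∩ G` for `F ⊆ G`. -/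
def sliceMap (U : Set E) {F G : Submodule ℝ E} (h : F ≤ G) : C(Slice U F, Slice U G) where
  toFun := Set.inclusion (Set.inter_subset_inter_right U h)
  continuous_toFun := continuous_inclusion _

/-- The inclusion `U ∩ F → U`. -/
def sliceIncl (U : Set E) (F : Submodule ℝ E) : C(Slice U F, U) where
  toFun := Set.inclusion Set.inter_subset_left
  continuous_toFun := continuous_inclusion _

/-- The bonding map `π_0(U ∩ F, p) → π_0(U ∩ G, p)` for `F ⊆ G` (a map of sets). -/
def bondMap (hU : p ∈ U) (F G : FinSubAt V p) (h : F ≤ G) :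
    π_ 0 (Slice U F.1) (slicePt hU F) → π_ 0 (Slice U G.1) (slicePt hU G) :=
  piMap 0 (sliceMap U h) rfl

/-- The bonding homomorphism `π_{k+1}(U ∩ F, p) → π_{k+1}(U ∩ G, p)` for `F ⊆ G`. -/
def bondHom (k : ℕ) (hU : p ∈ U) (F G : FinSubAt V p) (h : F ≤ G) :
    π_ (k + 1) (Slice U F.1) (slicePt hU F) →* π_ (k + 1) (Slice U G.1) (slicePt hU G) :=
  piHom k (sliceMap U h) rfl

instance (hU : p ∈ U) : DirectedSystem
    (fun F : FinSubAt V p => π_ 0 (Slice U F.1) (slicePt hU F))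
    (fun _ _ h => DFunLike.coe (bondMap hU _ _ h)) where
  map_self _ a := piMap_id 0 _ (fun _ => rfl) rfl a
  map_map _ _ _ hFG hGH a := piMap_comp 0 (sliceMap U hGH) (sliceMap U hFG)
    (sliceMap U (hFG.trans hGH)) (fun _ => rfl) rfl rfl rfl a

instance (k : ℕ) (hU : p ∈ U) : DirectedSystem
    (fun F : FinSubAt V p => π_ (k + 1) (Slice U F.1) (slicePt hU F)) (bondHom k hU · · ·) where
  map_self _ a := piMap_id (k + 1) _ (fun _ => rfl) rfl a
  map_map _ _ _ hFG hGH a := piMap_comp (k + 1) (sliceMap U hGH) (sliceMap U hFG)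
    (sliceMap U (hFG.trans hGH)) (fun _ => rfl) rfl rfl rfl a

/-- The direct limit `lim π_0(U ∩ F, p)` over `F ∈ ℱ_p`, in the category of sets. -/
abbrev LimPiZero (V : Submodule ℝ E) (hU : p ∈ U) : Type _ :=
  DirectLimit (fun F : FinSubAt V p => π_ 0 (Slice U F.1) (slicePt hU F)) (bondMap hU)

/-- The direct limit `lim π_{k+1}(U ∩ F, p)` over `F ∈ ℱ_p`, in the category of groups. -/
abbrev LimPi (k : ℕ) (V : Submodule ℝ E) (hU : p ∈ U) : Type _ :=
  DirectLimit (fun F : FinSubAt V p => π_ (k + 1) (Slice U F.1) (slicePt hU F)) (bondHom k hU)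

/-- The canonical map `lim π_0(U ∩ F, p) → π_0(U, p)` induced by the inclusions `U ∩ F → U`. -/
def limPiZeroMap (V : Submodule ℝ E) (hU : p ∈ U) : LimPiZero V hU → π_ 0 U ⟨p, hU⟩ :=
  DirectLimit.lift (bondMap hU)
    (fun F : FinSubAt V p => piMap 0 (sliceIncl U F.1) (rfl : _ = (⟨p, hU⟩ : U)))
    fun F G h a => (piMap_comp 0 (sliceIncl U G.1) (sliceMap U h) (sliceIncl U F.1)
      (fun _ => rfl) rfl rfl rfl a).symm

/-- The group structure on `lim π_{k+1}(U ∩ F, p)`. -/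
@[reducible]
def limPiGroup (k : ℕ) (hU : p ∈ U) (hV : p ∈ V) : Group (LimPi k V hU) :=
  haveI := finSubAt_nonempty hV
  inferInstance

/-- The canonical homomorphism of groups `lim π_{k+1}(U ∩ F, p) → π_{k+1}(U, p)` induced by the
inclusions `U ∩ F → U`. -/
def limPiHom (k : ℕ) (hU : p ∈ U) (hV : p ∈ V) :
    letI := limPiGroup k hU hV
    LimPi k V hU →* π_ (k + 1) U ⟨p, hU⟩ :=
  letI := limPiGroup k hU hV
  MonoidHom.mk'
    (DirectLimit.lift (bondHom k hU)
      (fun F : FinSubAt V p => piHom k (sliceIncl U F.1) (rfl : _ = (⟨p, hU⟩ : U)))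
      fun F G h a => (piMap_comp (k + 1) (sliceIncl U G.1) (sliceMap U h) (sliceIncl U F.1)
        (fun _ => rfl) rfl rfl rfl a).symm)
    (DirectLimit.lift_mul _ _)

end Limit

end PalaisFinite

end

namespace PalaisFinite

/-! ### Convex combinations with boundedly many terms -/

section Combinations

/-! The core is `exists_finiteDimensional_homotopicRel`: a cube in `U` with boundary in a
finite-dimensional `F ⊆ V` deforms, relative to the boundary, into a finite-dimensional subspace of
`V`. Replace `γ` by `∑ ψ_s q_s`, with `ψ` a fine partition of unity and `q_s ∈ U ∩ V` close to `γ
(v_s)`, and join the two by segments. Without local convexity such sums stay in `U` only if their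
number of terms is bounded in advance; on a `d`-cube at most `2 ^ d` of the `ψ_s` are nonzero at any
point, however fine the mesh. To fix the boundary, the approximation is blended with `γ ∘ r` on a
collar which `r` retracts to the boundary, where `γ` lies in `F`.

Applied to `k`-cubes, this shows that the slices exhaust `π_k(U, p)`; applied to homotopies, seen as
`(k + 1)`-cubes, it shows that classes merging in `U` already merge in a larger slice. This is the
direct limit statement. Since compact sets in the finite topology are finite-dimensional, `π_k(U_∞,
p)` is exhausted by the same slices, and the comparison with `U` follows. -/

theorem exists_nhds_zero_sum_mem {E : Type*} [AddCommMonoid E] [TopologicalSpace E] [ContinuousAdd E]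
    (m : ℕ) {W : Set E} (hW : W ∈ 𝓝 (0 : E)) :
    ∃ W' ∈ 𝓝 (0 : E), ∀ {ι : Type} (s : Finset ι) (z : ι → E), s.card ≤ m →
      (∀ i ∈ s, z i ∈ W') → ∑ i ∈ s, z i ∈ W := by
  classical
  induction m generalizing W with
  | zero =>
    refine ⟨W, hW, fun s z hs _ => ?_⟩
    rw [Finset.card_eq_zero.1 (Nat.le_zero.1 hs), Finset.sum_empty]
    exact mem_of_mem_nhds hW
  | succ m ih =>
    -- Half of `W` is spent on one term, the other half on the remaining `m`.
    obtain ⟨A, hA, hAW⟩ := exists_nhds_zero_half hW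
    obtain ⟨B, hB, hBA⟩ := ih hA
    refine ⟨A ∩ B, Filter.inter_mem hA hB, fun s z hs hz => ?_⟩
    rcases s.eq_empty_or_nonempty with rfl | ⟨a, ha⟩
    · rw [Finset.sum_empty]
      exact mem_of_mem_nhds hW
    · rw [← Finset.add_sum_erase s z ha]
      refine hAW _ (hz a ha).1 _ (hBA _ _ ?_ fun i hi => (hz i (Finset.mem_of_mem_erase hi)).2)
      rw [Finset.card_erase_of_mem ha]
      omega

variable {E : Type*} [AddCommGroup E] [Module ℝ E]

/-- All convex combinations of at most `m` points of `W` lie in `U`. -/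
def CombinationsLieIn (m : ℕ) (W U : Set E) : Prop :=
  ∀ {ι : Type} (s : Finset ι) (w : ι → ℝ) (z : ι → E), s.card ≤ m → (∀ i ∈ s, 0 ≤ w i) →
    ∑ i ∈ s, w i = 1 → (∀ i ∈ s, z i ∈ W) → ∑ i ∈ s, w i • z i ∈ U

variable [TopologicalSpace E]

/-- Each point of `U` has relative neighbourhoods all of whose convex combinations with a
prescribed bound on the number of points stay in `U`. -/
def HasLocalCombinations (U : Set E) : Prop :=
  ∀ (m : ℕ), ∀ p ∈ U, ∃ W ∈ 𝓝[U] p, CombinationsLieIn m W U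

/-- A convex neighbourhood serves every `m` at once. -/
theorem IsSemiLocallyConvex.hasLocalCombinations {U : Set E} (hU : IsSemiLocallyConvex U) :
    HasLocalCombinations U := by
  intro m p hp
  obtain ⟨W, hWU, hW, hc⟩ := hU p hp
  exact ⟨W, hW, fun s w z _ h0 h1 hz => hWU (hc.sum_mem h0 h1 hz)⟩

/-- After translation by `p`, a balanced neighbourhood of `0` absorbs weights in `[0, 1]`, so a
convex combination becomes a plain sum of at most `m` small vectors. -/
theorem hasLocalCombinations_of_isOpen [IsTopologicalAddGroup E] [ContinuousSMul ℝ E] {U : Set E}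
    (hU : IsOpen U) : HasLocalCombinations U := by
  intro m p hp
  have hW : (fun x => p + x) ⁻¹' U ∈ 𝓝 (0 : E) :=
    (hU.preimage (by fun_prop)).mem_nhds (by simpa using hp)
  obtain ⟨A, hA, hAW⟩ := exists_nhds_zero_sum_mem m hW
  obtain ⟨B, ⟨hB, hBb⟩, hBA⟩ := (nhds_basis_balanced ℝ E).mem_iff.1 hA
  refine ⟨(fun x => x - p) ⁻¹' B, mem_nhdsWithin_of_mem_nhds
    ((continuous_id.sub continuous_const).continuousAt.preimage_mem_nhds (by simpa using hB)),
    fun s w z hs h0 h1 hz => ?_⟩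
  have key : ∑ i ∈ s, w i • (z i - p) ∈ (fun x => p + x) ⁻¹' U := by
    refine hAW s _ hs fun i hi => hBA (hBb.smul_mem ?_ (hz i hi))
    rw [Real.norm_of_nonneg (h0 i hi), ← h1]
    exact Finset.single_le_sum h0 hi
  simpa [smul_sub, Finset.sum_sub_distrib, ← Finset.sum_smul, h1] using key

end Combinations

/-! ### Partitions of unity and collars on cubes -/

section Cubes

/-- Arbitrarily fine partitions of unity on a cube, with a bound on the multiplicity. -/
theorem exists_cube_partition (N : Type) [Fintype N] {δ : ℝ} (hδ : 0 < δ) :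
    ∃ (S : Type) (_ : Fintype S) (v : S → N → I) (ψ : S → C(N → I, ℝ)),
      (∀ s x, 0 ≤ ψ s x) ∧ (∀ x, ∑ s, ψ s x = 1) ∧ (∀ s x, ψ s x ≠ 0 → dist x (v s) < δ) ∧
      ∀ x, {s | ψ s x ≠ 0}.ncard ≤ 2 ^ Fintype.card N := by
  classical
  obtain ⟨n, hn⟩ := exists_nat_one_div_lt hδ
  set M : ℝ := n + 1 with hM
  have hM0 : 0 < M := by positivity
  -- Grid of mesh `1 / M < δ`, with coordinates `0, …, M = n + 1` in each direction; `χ s` is the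
  -- tent of radius `1 / M` at `v s` in the sup metric.
  let v : (N → Fin (n + 2)) → N → I := fun s i => ⟨(s i : ℝ) / M, by positivity, by
    rw [div_le_one hM0, hM]; exact_mod_cast Nat.lt_succ_iff.1 (s i).2⟩
  let χ : (N → Fin (n + 2)) → (N → I) → ℝ := fun s x => max 0 (1 - M * dist x (v s))
  have hχ0 : ∀ s x, 0 ≤ χ s x := fun s x => le_max_left _ _
  have hχc : ∀ s, Continuous (χ s) := fun s => by fun_prop
  have hχ : ∀ s x, χ s x ≠ 0 → dist x (v s) < 1 / M := by
    intro s x h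
    rw [lt_div_iff₀ hM0]
    by_contra! h'
    exact h (max_eq_left (by linarith))
  have hpos : ∀ x, 0 < ∑ s, χ s x := by
    intro x
    -- Rounding down coordinatewise finds a grid point at distance less than `1 / M`, so the tents
    -- have no common zero.
    have hfl : ∀ i, ⌊M * (x i : ℝ)⌋₊ < n + 2 := by
      intro i
      rw [Nat.floor_lt (mul_nonneg hM0.le (x i).2.1)]
      push_cast
      nlinarith [(x i).2.2]
    let s : N → Fin (n + 2) := fun i => ⟨⌊M * (x i : ℝ)⌋₊, hfl i⟩
    refine lt_of_lt_of_le ?_ (Finset.single_le_sum (fun s _ => hχ0 s x) (Finset.mem_univ s))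
    refine lt_max_of_lt_right ?_
    have : dist x (v s) < 1 / M := by
      rw [dist_pi_lt_iff (by positivity)]
      intro i
      have e : dist (x i) (v s i) = |M * (x i : ℝ) - (⌊M * (x i : ℝ)⌋₊ : ℝ)| / M := by
        rw [Subtype.dist_eq, Real.dist_eq, ← abs_of_pos hM0, ← abs_div, abs_of_pos hM0]
        congr 1
        simp only [v, s]
        field_simp
      rw [e]
      gcongr
      rw [abs_lt]
      have h1 := Nat.floor_le (mul_nonneg hM0.le (x i).2.1)
      have h2 := Nat.lt_floor_add_one (M * (x i : ℝ))
      constructor <;> linarith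
    rw [lt_div_iff₀ hM0] at this
    linarith
  refine ⟨N → Fin (n + 2), inferInstance, v,
    fun s => ⟨fun x => χ s x / ∑ s, χ s x, (hχc s).div
      (continuous_finsetSum _ fun s _ => hχc s) fun x => (hpos x).ne'⟩, ?_, ?_, ?_, ?_⟩
  · exact fun s x => div_nonneg (hχ0 s x) (hpos x).le
  · intro x
    simp only [ContinuousMap.coe_mk]
    rw [← Finset.sum_div, div_self (hpos x).ne']
  · intro s x h
    exact (hχ s x fun h0 => h (by simp [h0])).trans hn
  · intro x
    have hcard : Fintype.card (N → Bool) = 2 ^ Fintype.card N := by simp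
    rw [← hcard, ← Nat.card_eq_fintype_card, ← Set.ncard_univ]
    -- Active grid points at `x` differ by at most one in each coordinate, so their parities tell
    -- them apart.
    refine Set.ncard_le_ncard_of_injOn (fun s i => decide ((s i : ℕ) % 2 = 0))
      (fun _ _ => Set.mem_univ _) ?_ Set.finite_univ
    intro s hs s' hs' h
    have near : ∀ s : N → Fin (n + 2), χ s x / ∑ s, χ s x ≠ 0 → ∀ i,
        |M * (x i : ℝ) - (s i : ℕ)| < 1 := by
      intro s hs i
      have h1 := (dist_le_pi_dist x (v s) i).trans_lt (hχ s x fun h0 => hs (by simp [h0]))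
      rw [Subtype.dist_eq, Real.dist_eq, lt_div_iff₀ hM0] at h1
      rw [show M * (x i : ℝ) - (s i : ℕ) = ((x i : ℝ) - (v s i : ℝ)) * M by
        simp only [v]; field_simp, abs_mul, abs_of_pos hM0]
      exact h1
    funext i
    have h1 := abs_lt.1 (near s hs i)
    have h2 := abs_lt.1 (near s' hs' i)
    have h3 : (s i : ℕ) < (s' i : ℕ) + 2 := by
      have : ((s i : ℕ) : ℝ) < (s' i : ℕ) + 2 := by linarith
      exact_mod_cast this
    have h4 : (s' i : ℕ) < (s i : ℕ) + 2 := by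
      have : ((s' i : ℕ) : ℝ) < (s i : ℕ) + 2 := by linarith
      exact_mod_cast this
    have h5 : ((s i : ℕ) % 2 = 0) ↔ ((s' i : ℕ) % 2 = 0) := by simpa using congrFun h i
    ext
    omega

/-- A thin collar of the boundary of a cube can be pushed onto the boundary. -/
theorem exists_cube_collar (N : Type) [Fintype N] {δ : ℝ} (hδ : 0 < δ) :
    ∃ (r : C(N → I, N → I)) (φ : C(N → I, ℝ)), (∀ x, 0 ≤ φ x ∧ φ x ≤ 1) ∧
      (∀ x ∈ Cube.boundary N, φ x = 0 ∧ r x = x) ∧ (∀ x, φ x ≠ 1 → r x ∈ Cube.boundary N) ∧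
      ∀ x, dist (r x) x < δ := by
  set ε : ℝ := min δ 1 / 2 with hε
  have hε0 : 0 < ε := by positivity
  have hε1 : ε < 1 := by have := min_le_right δ 1; linarith
  have hεδ : ε < δ := by have := min_le_left δ 1; linarith [lt_min hδ one_pos]
  let y : (N → I) → N → ℝ := fun x i => 2 * (x i : ℝ) - 1
  have hyc : Continuous y := by fun_prop
  have hy1 : ∀ x, ‖y x‖ ≤ 1 := fun x => (pi_norm_le_iff_of_nonneg zero_le_one).2 fun i => by
    rw [Real.norm_eq_abs, abs_le]
    constructor <;> simp only [y] <;> linarith [(x i).2.1, (x i).2.2]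
  -- In the centred coordinates `y`, `r` is `y ↦ y / c`: it stretches the inner cube `‖y‖ ≤ 1 - ε`
  -- to the whole cube and projects the collar radially to the boundary.
  let c : (N → I) → ℝ := fun x => max ‖y x‖ (1 - ε)
  have hc0 : ∀ x, 0 < c x := fun x => lt_max_of_lt_right (by linarith)
  have hcc : Continuous c := by fun_prop
  have hyn : ∀ x i, |y x i| ≤ c x := fun x i => (norm_le_pi_norm (y x) i).trans (le_max_left _ _)
  have hq : ∀ x i, |y x i / c x| ≤ 1 := fun x i => by
    rw [abs_div, abs_of_pos (hc0 x), div_le_one (hc0 x)]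
    exact hyn x i
  have hbd : ∀ x : N → I, x ∈ Cube.boundary N ↔ ∃ i, |y x i| = 1 := by
    intro x
    refine exists_congr fun i => ?_
    rw [abs_eq zero_le_one, Subtype.ext_iff, Subtype.ext_iff]
    simp only [y, Set.Icc.coe_zero, Set.Icc.coe_one]
    constructor <;> rintro (h | h)
    · exact Or.inr (by linarith)
    · exact Or.inl (by linarith)
    · exact Or.inr (by linarith)
    · exact Or.inl (by linarith)
  let r : C(N → I, N → I) := ⟨fun x i => ⟨(1 + y x i / c x) / 2, by
      have := abs_le.1 (hq x i); linarith, by have := abs_le.1 (hq x i); linarith⟩, by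
    refine continuous_pi fun i => Continuous.subtype_mk ?_ _
    exact (continuous_const.add (((continuous_apply i).comp hyc).div hcc
      fun x => (hc0 x).ne')).div_const 2⟩
  have hyr : ∀ x i, y (r x) i = y x i / c x := fun x i => by
    change 2 * ((1 + y x i / c x) / 2) - 1 = y x i / c x
    ring
  refine ⟨r, ⟨fun x => min 1 ((1 - ‖y x‖) / ε), by fun_prop⟩, ?_, ?_, ?_, ?_⟩
  · exact fun x => ⟨le_min zero_le_one (div_nonneg (by linarith [hy1 x]) hε0.le), min_le_left _ _⟩
  · intro x hx
    obtain ⟨i, hi⟩ := (hbd x).1 hx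
    have hn : ‖y x‖ = 1 := le_antisymm (hy1 x) (hi ▸ norm_le_pi_norm (y x) i)
    have hcx : c x = 1 := by simp only [c, hn]; exact max_eq_left (by linarith)
    refine ⟨by simp [hn], funext fun j => Subtype.ext ?_⟩
    simp only [r, y, ContinuousMap.coe_mk, hcx]
    ring
  · intro x hx
    have hlt : 1 - ε < ‖y x‖ := by
      by_contra! h
      refine hx (min_eq_left ?_)
      rw [le_div_iff₀ hε0]
      linarith
    have hcx : c x = ‖y x‖ := max_eq_left hlt.le
    obtain ⟨i, hi⟩ : ∃ i, ‖y x‖ ≤ |y x i| := by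
      by_contra! h
      exact lt_irrefl _ ((pi_norm_lt_iff (by linarith)).2 h)
    have hi' : |y x i| = ‖y x‖ := le_antisymm (norm_le_pi_norm (y x) i) hi
    refine (hbd _).2 ⟨i, ?_⟩
    rw [hyr, abs_div, abs_of_pos (hc0 x), div_eq_one_iff_eq (hc0 x).ne', hcx, hi']
  · intro x
    refine lt_of_le_of_lt ((dist_pi_le_iff hε0.le).2 fun i => ?_) hεδ
    have e : ((r x i : ℝ) - x i) = y x i / c x * (1 - c x) / 2 := by
      simp only [r, ContinuousMap.coe_mk]
      rw [show (x i : ℝ) = (1 + y x i) / 2 by simp only [y]; ring]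
      have := (hc0 x).ne'
      field_simp
      ring
    have h1 : 0 ≤ 1 - c x := by
      have : c x ≤ 1 := max_le (hy1 x) (by linarith)
      linarith
    have h2 : 1 - c x ≤ ε := by
      have : 1 - ε ≤ c x := le_max_right _ _
      linarith
    rw [Subtype.dist_eq, Real.dist_eq, e, abs_div, abs_mul, abs_of_nonneg h1, abs_two]
    have := mul_le_of_le_one_left h1 (hq x i)
    linarith

end Cubes

/-! ### Finite-dimensional approximation of cubes -/

section Approximation

variable {E : Type*} [AddCommGroup E] [Module ℝ E] [TopologicalSpace E]
  [IsTopologicalAddGroup E] [ContinuousSMul ℝ E]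

/-- A map from a cube to `U` which takes the boundary into a finite-dimensional subspace `F ⊆ V` is
homotopic, relative to the boundary, to a map into a finite-dimensional subspace of `V`. -/
theorem exists_finiteDimensional_homotopicRel {N : Type} [Fintype N] {U : Set E}
    (hU : HasLocalCombinations U) {V : Submodule ℝ E} (hV : Dense {x : U | (x : E) ∈ V})
    {F : Submodule ℝ E} (hFV : F ≤ V) [FiniteDimensional ℝ F] (γ : C(N → I, U))
    (hγ : ∀ x ∈ Cube.boundary N, (γ x : E) ∈ F) :
    ∃ (G : Submodule ℝ E) (η : C(N → I, U)), F ≤ G ∧ G ≤ V ∧ FiniteDimensional ℝ G ∧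
      (∀ x, (η x : E) ∈ G) ∧ γ.HomotopicRel η (Cube.boundary N) := by
  classical
  -- At most `2 ^ card N` active points `q s`, together with `γ x` and `γ (r x)`; the bound is known
  -- before the mesh is chosen.
  set m : ℕ := 2 ^ Fintype.card N + 2
  have hO : ∀ p : U, ∃ O : Set U, IsOpen O ∧ p ∈ O ∧ CombinationsLieIn m (Subtype.val '' O) U := by
    intro p
    obtain ⟨W, hW, hc⟩ := hU m p p.2
    rw [← preimage_coe_mem_nhds_subtype] at hW
    refine ⟨interior (Subtype.val ⁻¹' W), isOpen_interior, mem_interior_iff_mem_nhds.2 hW, ?_⟩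
    intro ι s w z hs h0 h1 hz
    refine hc s w z hs h0 h1 fun i hi => ?_
    obtain ⟨x, hx, hxz⟩ := hz i hi
    exact hxz ▸ (interior_subset hx : x ∈ Subtype.val ⁻¹' W)
  choose O hOo hpO hOc using hO
  obtain ⟨T, hT⟩ := isCompact_univ.elim_finite_subcover (fun p => γ ⁻¹' O p)
    (fun p => (hOo p).preimage γ.continuous)
    (fun x _ => Set.mem_iUnion.2 ⟨γ x, hpO (γ x)⟩)
  obtain ⟨δ, hδ, hball⟩ := lebesgue_number_lemma_of_metric (c := fun p : T => γ ⁻¹' O p)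
    isCompact_univ (fun p => (hOo p).preimage γ.continuous) (fun x hx => by
      simpa using hT hx)
  obtain ⟨S, _, v, ψ, hψ0, hψ1, hψδ, hψm⟩ := exists_cube_partition N hδ
  obtain ⟨r, φ, hφ, hφb, hrb, hrδ⟩ := exists_cube_collar N hδ
  -- The `O p` used later depends on `x`, so `q s` must lie in all those containing `γ (v s)`;
  -- finiteness of `T` keeps the intersection open.
  have hq : ∀ s : S, ∃ q : U, (q : E) ∈ V ∧ ∀ p ∈ T, γ (v s) ∈ O p → q ∈ O p := by
    intro s
    obtain ⟨q, hq, hqV⟩ := hV.inter_open_nonempty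
      (⋂ p ∈ T.filter fun p => γ (v s) ∈ O p, O p)
      (isOpen_biInter_finset fun p _ => hOo p) ⟨γ (v s), by simp⟩
    refine ⟨q, hqV, fun p hp hs => ?_⟩
    exact Set.mem_iInter₂.1 hq p (Finset.mem_filter.2 ⟨hp, hs⟩)
  choose q hqV hqO using hq
  -- The segment from `γ x` to `(1 - φ x) γ (r x) + φ x ∑ ψ_s(x) q_s`, written as a single convex
  -- combination.
  let w : I → (N → I) → Option (Option S) → ℝ := fun t x i =>
    i.elim (1 - t) fun j => j.elim (t * (1 - φ x)) fun s => t * (φ x * ψ s x)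
  let z : (N → I) → Option (Option S) → E := fun x i =>
    i.elim (γ x : E) fun j => j.elim (γ (r x) : E) fun s => (q s : E)
  let h : I × (N → I) → E := fun a => ∑ i, w a.1 a.2 i • z a.2 i
  have h_eq : ∀ a, h a = (1 - (a.1 : ℝ)) • (γ a.2 : E) + ((a.1 * (1 - φ a.2)) • (γ (r a.2) : E) +
      ∑ s, ((a.1 : ℝ) * (φ a.2 * ψ s a.2)) • (q s : E)) := fun a => by
    simp [h, w, z, Fintype.sum_option]
  have hhc : Continuous h := by
    rw [funext h_eq]
    fun_prop
  have hhU : ∀ a, h a ∈ U := by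
    rintro ⟨t, x⟩
    obtain ⟨p, hp⟩ := hball x (Set.mem_univ x)
    have hw0 : ∀ i, 0 ≤ w t x i := by
      have ht0 := t.2.1
      have ht1 := t.2.2
      rintro (_ | _ | s)
      · exact sub_nonneg.2 ht1
      · exact mul_nonneg ht0 (sub_nonneg.2 (hφ x).2)
      · exact mul_nonneg ht0 (mul_nonneg (hφ x).1 (hψ0 s x))
    have hw1 : ∑ i, w t x i = 1 := by
      simp only [Fintype.sum_option, w, Option.elim_none, Option.elim_some, ← Finset.mul_sum, hψ1]
      ring
    have hsum : h (t, x) = ∑ i with w t x i ≠ 0, w t x i • z x i := by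
      -- Terms of weight zero are dropped: their points may be far away, and they would break the
      -- bound `m`.
      refine (Finset.sum_filter_of_ne (p := fun i => w t x i ≠ 0) fun i _ hi h0 => hi ?_).symm
      rw [h0, zero_smul]
    rw [hsum]
    refine hOc p _ _ _ ?_ (fun i _ => hw0 i) (by rw [Finset.sum_filter_ne_zero, hw1]) ?_
    · have hsub : (Finset.univ.filter fun i => w t x i ≠ 0) ⊆
          insert none (insert (some none)
            ((Finset.univ.filter fun s => ψ s x ≠ 0).image fun s => some (some s))) := by
        rintro (_ | _ | s) hi
        · simp
        · simp
        · have : ψ s x ≠ 0 := fun h0 => (Finset.mem_filter.1 hi).2 (by simp [w, h0])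
          simp [this]
      have hcard : (Finset.univ.filter fun s => ψ s x ≠ 0).card ≤ 2 ^ Fintype.card N := by
        rw [← Set.ncard_coe_finset]
        simpa using hψm x
      refine (Finset.card_le_card hsub).trans ((Finset.card_insert_le _ _).trans ?_)
      have h1 := Finset.card_insert_le (some none)
        ((Finset.univ.filter fun s => ψ s x ≠ 0).image fun s => some (some s))
      have h2 := Finset.card_image_le (s := Finset.univ.filter fun s => ψ s x ≠ 0)
        (f := fun s => some (some s))
      omega
    · rintro (_ | _ | s) hi
      · exact ⟨γ x, hp (Metric.mem_ball_self hδ), rfl⟩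
      · exact ⟨γ (r x), hp (hrδ x), rfl⟩
      · have : ψ s x ≠ 0 := fun h0 => (Finset.mem_filter.1 hi).2 (by simp [w, h0])
        refine ⟨q s, hqO s p p.2 (hp ?_), rfl⟩
        rw [Metric.mem_ball, dist_comm]
        exact hψδ s x this
  let H : C(I × (N → I), U) := ⟨fun a => ⟨h a, hhU a⟩, hhc.subtype_mk _⟩
  refine ⟨F ⊔ Submodule.span ℝ (Set.range fun s => (q s : E)), H.comp ⟨fun x => (1, x), by fun_prop⟩,
    le_sup_left, sup_le hFV (Submodule.span_le.2 ?_), ?_, ?_, ⟨⟨⟨H, ?_, ?_⟩, ?_⟩⟩⟩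
  · rintro _ ⟨s, rfl⟩
    exact hqV s
  · have := FiniteDimensional.span_of_finite ℝ (Set.finite_range fun s => (q s : E))
    infer_instance
  · intro x
    change h (1, x) ∈ _
    simp only [h_eq, Set.Icc.coe_one, sub_self, zero_smul, zero_add, one_mul]
    refine Submodule.add_mem _ ?_ (Submodule.sum_mem _ fun s _ => Submodule.smul_mem _ _
      (Submodule.mem_sup_right (Submodule.subset_span ⟨s, rfl⟩)))
    -- Either the `γ (r x)` term vanishes, or `r x` is on the boundary, where `γ` takes values in
    -- `F`.
    by_cases h1 : φ x = 1
    · simp [h1]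
    · exact Submodule.smul_mem _ _ (Submodule.mem_sup_left (hγ _ (hrb x h1)))
  · intro x
    refine Subtype.ext ((h_eq _).trans ?_)
    simp
  · intro x
    rfl
  · intro t x hx
    refine Subtype.ext ((h_eq _).trans ?_)
    obtain ⟨h0, h1⟩ := hφb x hx
    simp only [h0, h1, sub_zero, mul_one, zero_mul, mul_zero, zero_smul, Finset.sum_const_zero,
      add_zero, ← add_smul, sub_add_cancel, one_smul]

end Approximation

/-! ### Compact sets in the finite topology -/

section FiniteTopology

variable {E : Type*} [AddCommGroup E] [Module ℝ E] [TopologicalSpace E]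

theorem continuous_toWithFiniteTopology (V : Submodule ℝ E) (F : FinSub V) :
    Continuous (toWithFiniteTopology V F) :=
  continuous_iff_coinduced_le.2 (le_iSup (fun F : FinSub V =>
    TopologicalSpace.coinduced (toWithFiniteTopology V F) inferInstance) F)

/-- Compact sets in the finite topology are finite-dimensional. -/
theorem exists_finSub_of_isCompact [T1Space E] {V : Submodule ℝ E} {K : Set (WithFiniteTopology V)}
    (hK : IsCompact K) : ∃ F : FinSub V, ∀ x ∈ K, WithFiniteTopology.incl V x ∈ F.1 := by
  have hinj : Function.Injective (WithFiniteTopology.incl V) := V.injective_subtype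
  obtain ⟨b, hbK, hspan, hb⟩ := exists_linearIndependent ℝ (WithFiniteTopology.incl V '' K)
  have hbV : b ⊆ V := by
    intro x hx
    obtain ⟨y, -, rfl⟩ := hbK hx
    exact Submodule.coe_mem (p := V) y
  -- A finite-dimensional subspace contains only finitely many elements of the independent set `b`,
  -- so every subset of `b` is closed. Thus `b` is closed and discrete inside the compact `K`, hence
  -- finite.
  have hclosed : ∀ s ⊆ b, IsClosed (WithFiniteTopology.incl V ⁻¹' s) := by
    intro s hs
    refine isClosed_iSup_iff.2 fun F => isClosed_coinduced.2 ?_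
    have := F.2.2
    have hfin : (Subtype.val ⁻¹' s : Set F.1).Finite := by
      have : LinearIndependent ℝ (Subtype.val : (Subtype.val ⁻¹' s : Set F.1) → F.1) := by
        refine LinearIndependent.of_comp F.1.subtype ?_
        exact (LinearIndepOn.mono (v := id) hb hs).comp (fun x : (Subtype.val ⁻¹' s : Set F.1) => (⟨x.1.1, x.2⟩ : s))
          fun x y h => Subtype.ext (Subtype.ext (congrArg (fun z : s => (z : E)) h))
      exact this.setFinite
    exact hfin.isClosed
  have hfin : (WithFiniteTopology.incl V ⁻¹' b).Finite := by
    have hc : IsCompact (WithFiniteTopology.incl V ⁻¹' b) := by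
      refine hK.of_isClosed_subset (hclosed b subset_rfl) fun x hx => ?_
      obtain ⟨y, hy, hxy⟩ := hbK hx
      exact hinj hxy ▸ hy
    have : DiscreteTopology (WithFiniteTopology.incl V ⁻¹' b) := by
      refine discreteTopology_iff_forall_isClosed.2 fun s => ?_
      have h := (hclosed (WithFiniteTopology.incl V '' (Subtype.val '' s)) (by
        rintro _ ⟨_, ⟨x, -, rfl⟩, rfl⟩
        exact x.2)).preimage
          (continuous_subtype_val : Continuous
            (Subtype.val : WithFiniteTopology.incl V ⁻¹' b → WithFiniteTopology V))
      rwa [hinj.preimage_image, Subtype.val_injective.preimage_image] at h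
    have := isCompact_iff_compactSpace.1 hc
    exact finite_of_compact_of_discrete (X := WithFiniteTopology.incl V ⁻¹' b)
  have hbfin : b.Finite := by
    refine (hfin.image (WithFiniteTopology.incl V)).subset fun x hx => ?_
    obtain ⟨y, -, rfl⟩ := hbK hx
    exact ⟨y, hx, rfl⟩
  refine ⟨⟨Submodule.span ℝ b, Submodule.span_le.2 hbV,
    FiniteDimensional.span_of_finite ℝ hbfin⟩, fun x hx => ?_⟩
  exact hspan.ge (Submodule.subset_span ⟨x, hx, rfl⟩)

end FiniteTopology

/-! ### Path components and `π_0` -/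

theorem pathComponentsMap_pi0EquivZerothHomotopy {X Y : Type*} [TopologicalSpace X]
    [TopologicalSpace Y] (f : C(X, Y)) (x : X) (a : π_ 0 X x) :
    pathComponentsMap f (HomotopyGroup.pi0EquivZerothHomotopy a) =
      HomotopyGroup.pi0EquivZerothHomotopy (piMap 0 f (rfl : f x = f x) a) := by
  induction a using Quotient.inductionOn with
  | h γ => rfl

/-- `π_0` does not see its base point, so one base point suffices. -/
theorem pathComponentsMap_bijective {X Y : Type*} [TopologicalSpace X] [TopologicalSpace Y]
    (f : C(X, Y)) (x : X) (h : Function.Bijective (piMap 0 f (rfl : f x = f x))) :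
    Function.Bijective (pathComponentsMap f) := by
  have e : pathComponentsMap f ∘ HomotopyGroup.pi0EquivZerothHomotopy (x := x) =
      HomotopyGroup.pi0EquivZerothHomotopy ∘ piMap 0 f (rfl : f x = f x) :=
    funext (pathComponentsMap_pi0EquivZerothHomotopy f x)
  rw [← Function.Bijective.of_comp_iff _ HomotopyGroup.pi0EquivZerothHomotopy.bijective, e]
  exact HomotopyGroup.pi0EquivZerothHomotopy.bijective.comp h

/-! ### Homotopy classes and finite-dimensional slices -/

section Slices

variable {E : Type*} [AddCommGroup E] [Module ℝ E] [TopologicalSpace E]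
  {U : Set E} {V : Submodule ℝ E} {p : E}

section TopologicalVectorSpace

variable [IsTopologicalAddGroup E] [ContinuousSMul ℝ E]

/-- Each class in `π_k(U, p)` comes from a finite-dimensional slice. -/
theorem exists_piMap_sliceIncl_eq (hU : HasLocalCombinations U)
    (hV : Dense {x : U | (x : E) ∈ V}) (k : ℕ) (hpU : p ∈ U) (hpV : p ∈ V)
    (a : π_ k U ⟨p, hpU⟩) :
    ∃ (F : FinSubAt V p) (b : π_ k (Slice U F.1) (slicePt hpU F)),
      piMap k (sliceIncl U F.1) (rfl : _ = (⟨p, hpU⟩ : U)) b = a := by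
  induction a using Quotient.inductionOn with
  | h γ =>
    obtain ⟨G, η, hFG, hGV, hG, hη, hom⟩ := exists_finiteDimensional_homotopicRel hU hV
      (F := Submodule.span ℝ {p}) (by simpa using hpV) γ.1 (fun x hx => by
        rw [γ.2 x hx]
        exact Submodule.mem_span_singleton_self p)
    have hbd : ∀ x ∈ Cube.boundary (Fin k), η x = ⟨p, hpU⟩ := fun x hx => by
      rw [← hom.some.fst_eq_snd hx]
      exact γ.2 x hx
    refine ⟨⟨G, hGV, hG, hFG (Submodule.mem_span_singleton_self p)⟩, Quotient.mk _
      ⟨⟨fun x => ⟨η x, (η x).2, hη x⟩, by fun_prop⟩, fun x hx =>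
        Subtype.ext (congrArg Subtype.val (hbd x hx) : (η x : E) = p)⟩, ?_⟩
    exact Quotient.sound hom.symm

/-- Two classes of a finite-dimensional slice which agree in `π_k(U, p)` agree in a larger
finite-dimensional slice. -/
theorem exists_piMap_sliceMap_eq (hU : HasLocalCombinations U)
    (hV : Dense {x : U | (x : E) ∈ V}) (k : ℕ) (hpU : p ∈ U) (F : FinSubAt V p)
    (a b : π_ k (Slice U F.1) (slicePt hpU F))
    (hab : piMap k (sliceIncl U F.1) (rfl : _ = (⟨p, hpU⟩ : U)) a =
      piMap k (sliceIncl U F.1) (rfl : _ = (⟨p, hpU⟩ : U)) b) :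
    ∃ (G : FinSubAt V p) (h : F ≤ G),
      piMap k (sliceMap U h) (rfl : _ = slicePt hpU G) a =
        piMap k (sliceMap U h) (rfl : _ = slicePt hpU G) b := by
  induction a using Quotient.inductionOn with
  | h α =>
  induction b using Quotient.inductionOn with
  | h β =>
    obtain ⟨H⟩ : ((genLoopMap (sliceIncl U F.1) _ α).1).HomotopicRel
      (genLoopMap (sliceIncl U F.1) _ β).1 (Cube.boundary (Fin k)) := Quotient.exact hab
    have H0 : ∀ x, (H (0, x) : E) = α x := fun x => congrArg Subtype.val (H.apply_zero x)
    have H1 : ∀ x, (H (1, x) : E) = β x := fun x => congrArg Subtype.val (H.apply_one x)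
    have Hb : ∀ t, ∀ x ∈ Cube.boundary (Fin k), (H (t, x) : E) = p := fun t x hx =>
      (congrArg Subtype.val (H.eq_fst t hx)).trans (congrArg Subtype.val (α.2 x hx))
    -- The homotopy as a `(k + 1)`-cube with time as coordinate `0`. Its time faces are `α` and `β`,
    -- the others are constant at `p`, so the whole boundary lies in `F`. The deformation fixes
    -- these faces, so its result is again a homotopy from `α` to `β`.
    let Γ : C(Fin (k + 1) → I, U) := ⟨fun y => H (y 0, fun i => y i.succ), by fun_prop⟩
    have hFfin := F.2.2.1
    obtain ⟨G, η, hFG, hGV, hG, hη, hom⟩ := exists_finiteDimensional_homotopicRel hU hV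
      (F := F.1) F.2.1 Γ (by
        rintro y ⟨i, hi⟩
        change (H (y 0, fun i => y i.succ) : E) ∈ F.1
        induction i using Fin.cases with
        | zero =>
          rcases hi with hi | hi
          · rw [hi, H0]
            exact (α _).2.2
          · rw [hi, H1]
            exact (β _).2.2
        | succ i =>
          rw [Hb _ _ ⟨i, hi⟩]
          exact F.2.2.2)
    have hηb : ∀ t x, (Fin.cons t x : Fin (k + 1) → I) ∈ Cube.boundary (Fin (k + 1)) →
        η (Fin.cons t x : Fin (k + 1) → I) = H (t, x) := fun t x h =>
      (hom.some.fst_eq_snd h).symm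
    have hc : Continuous fun y : I × (Fin k → I) => (Fin.cons y.1 y.2 : Fin (k + 1) → I) := by
      refine continuous_pi fun i => ?_
      induction i using Fin.cases with
      | zero => exact continuous_fst
      | succ i => exact (continuous_apply i).comp continuous_snd
    refine ⟨⟨G, hGV, hG, hFG F.2.2.2⟩, hFG, Quotient.sound
      ⟨⟨⟨⟨fun y => ⟨η (Fin.cons y.1 y.2 : Fin (k + 1) → I), (η _).2, hη _⟩, ?_⟩, ?_, ?_⟩, ?_⟩⟩⟩
    · exact (continuous_subtype_val.comp (η.continuous.comp hc)).subtype_mk _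
    · intro x
      refine Subtype.ext ((congrArg Subtype.val (hηb 0 x ⟨0, Or.inl rfl⟩)).trans (H0 x))
    · intro x
      refine Subtype.ext ((congrArg Subtype.val (hηb 1 x ⟨0, Or.inr rfl⟩)).trans (H1 x))
    · rintro t x ⟨i, hi⟩
      refine Subtype.ext ((congrArg Subtype.val (hηb t x ⟨i.succ, hi⟩)).trans
        ((Hb t x ⟨i, hi⟩).trans ?_))
      exact (congrArg Subtype.val (α.2 x ⟨i, hi⟩)).symm

end TopologicalVectorSpace

/-- The inclusion `U ∩ F → U_∞`. -/
def sliceToUInfty (U : Set E) {V : Submodule ℝ E} (F : FinSub V) : C(Slice U F.1, UInfty U V) where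
  toFun x := ⟨toWithFiniteTopology V F ⟨x.1, x.2.2⟩, x.2.1⟩
  continuous_toFun := ((continuous_toWithFiniteTopology V F).comp (by fun_prop)).subtype_mk _

/-- A member of `ℱ_p` as a finite-dimensional vector subspace of `V`. -/
abbrev FinSubAt.toFinSub (F : FinSubAt V p) : FinSub V := ⟨F.1, F.2.1, F.2.2.1⟩

/-- The point `p` of `U_∞`. -/
abbrev uInftyPt (hpU : p ∈ U) (hpV : p ∈ V) : UInfty U V :=
  ⟨(⟨p, hpV⟩ : V), hpU⟩

/-- The homotopy classes in `U_∞` come from finite-dimensional slices. -/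
theorem exists_piMap_sliceToUInfty_eq [T1Space E] (k : ℕ) (hpU : p ∈ U) (hpV : p ∈ V)
    (a : π_ k (UInfty U V) (uInftyPt hpU hpV)) :
    ∃ F : FinSubAt V p, ∀ (G : FinSubAt V p), F ≤ G → ∃ b : π_ k (Slice U G.1) (slicePt hpU G),
      piMap k (sliceToUInfty U G.toFinSub) (rfl : _ = uInftyPt hpU hpV) b = a := by
  induction a using Quotient.inductionOn with
  | h γ =>
    -- The image of the cube is compact. Every larger slice contains it too, which lets two classes
    -- be lifted to a common slice.
    obtain ⟨F, hF⟩ := exists_finSub_of_isCompact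
      (isCompact_range (f := fun t => (γ t).1) (by fun_prop))
    have := F.2.2
    refine ⟨⟨F.1 ⊔ Submodule.span ℝ {p}, sup_le F.2.1 (by simpa using hpV), inferInstance,
      Submodule.mem_sup_right (Submodule.mem_span_singleton_self p)⟩, fun G hG => ?_⟩
    refine ⟨Quotient.mk _ ⟨⟨fun t => ⟨UInfty.incl U V (γ t), (γ t).2,
      hG (Submodule.mem_sup_left (hF _ ⟨t, rfl⟩))⟩, by fun_prop⟩, fun t ht => ?_⟩, ?_⟩
    · exact Subtype.ext (congrArg (fun z => (UInfty.incl U V z : E)) (γ.2 t ht))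
    · rfl

/-- The inclusion of a slice into `U` factors through `U_∞`, so lifting and merging of classes in
slices transfer to `U_∞`. -/
theorem piMap_incl_bijective [IsTopologicalAddGroup E] [ContinuousSMul ℝ E] [T1Space E]
    (hU : HasLocalCombinations U) (hV : Dense {x : U | (x : E) ∈ V}) (k : ℕ)
    (hpU : p ∈ U) (hpV : p ∈ V) :
    Function.Bijective (piMap k (UInfty.incl U V)
      (rfl : UInfty.incl U V (uInftyPt hpU hpV) = UInfty.incl U V (uInftyPt hpU hpV))) := by
  constructor
  · intro a b hab
    obtain ⟨F₁, hF₁⟩ := exists_piMap_sliceToUInfty_eq k hpU hpV a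
    obtain ⟨F₂, hF₂⟩ := exists_piMap_sliceToUInfty_eq k hpU hpV b
    obtain ⟨F, h₁, h₂⟩ := exists_ge_ge F₁ F₂
    obtain ⟨a, rfl⟩ := hF₁ F h₁
    obtain ⟨b, rfl⟩ := hF₂ F h₂
    have e := fun c : π_ k (Slice U F.1) (slicePt hpU F) => piMap_comp k (UInfty.incl U V) (sliceToUInfty U F.toFinSub)
      (sliceIncl U F.1) (fun _ => rfl) (rfl : _ = uInftyPt hpU hpV)
      (rfl : UInfty.incl U V (uInftyPt hpU hpV) = UInfty.incl U V (uInftyPt hpU hpV)) rfl c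
    obtain ⟨G, h, hG⟩ := exists_piMap_sliceMap_eq hU hV k hpU F a b
      ((e a).symm.trans (hab.trans (e b)))
    have e' := fun c : π_ k (Slice U F.1) (slicePt hpU F) => piMap_comp k (sliceToUInfty U G.toFinSub) (sliceMap U h)
      (sliceToUInfty U F.toFinSub) (fun _ => rfl) (rfl : _ = slicePt hpU G)
      (rfl : _ = uInftyPt hpU hpV) rfl c
    exact (e' a).symm.trans ((congrArg (piMap k (sliceToUInfty U G.toFinSub)
      (rfl : _ = uInftyPt hpU hpV)) hG).trans (e' b))
  · intro a
    obtain ⟨F, b, rfl⟩ := exists_piMap_sliceIncl_eq hU hV k hpU hpV a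
    exact ⟨piMap k (sliceToUInfty U F.toFinSub) rfl b, piMap_comp k (UInfty.incl U V)
      (sliceToUInfty U F.toFinSub) (sliceIncl U F.1) (fun _ => rfl) rfl rfl rfl b⟩

end Slices

end PalaisFinite

theorem mainTheorem4 {E : Type*} [AddCommGroup E] [Module ℝ E] [TopologicalSpace E]
    [IsTopologicalAddGroup E] [ContinuousSMul ℝ E] [T2Space E]
    (U : Set E) (hU : IsOpen U ∨ PalaisFinite.IsSemiLocallyConvex U)
    (V : Submodule ℝ E) (hV : Dense {x : U | (x : E) ∈ V}) :
    PalaisFinite.IsWeakHomotopyEquiv (PalaisFinite.UInfty.incl U V) ∧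
      ∀ (p : E) (hpU : p ∈ U) (hpV : p ∈ V),
        Function.Bijective (PalaisFinite.limPiZeroMap V hpU) ∧
        ∀ k : ℕ, Function.Bijective (PalaisFinite.limPiHom k hpU hpV) := by
  have hU' : PalaisFinite.HasLocalCombinations U :=
    hU.elim PalaisFinite.hasLocalCombinations_of_isOpen
      PalaisFinite.IsSemiLocallyConvex.hasLocalCombinations
  have hbij : ∀ (k : ℕ) (x : PalaisFinite.UInfty U V), Function.Bijective
      (PalaisFinite.piMap k (PalaisFinite.UInfty.incl U V) (rfl : _ = _)) := fun k x =>
    PalaisFinite.piMap_incl_bijective hU' hV k x.2 (Submodule.coe_mem (p := V) x.1)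
  refine ⟨⟨?_, hbij⟩, fun p hpU hpV => ⟨⟨?_, ?_⟩, fun k => ⟨?_, ?_⟩⟩⟩
  -- The passage to `π_0` needs a base point in `U_∞`, which density provides unless `U` is empty.
  · rcases isEmpty_or_nonempty U with hE | hE
    · have : IsEmpty (PalaisFinite.UInfty U V) := ⟨fun x => hE.elim ⟨_, x.2⟩⟩
      exact ⟨fun a => a.inductionOn fun x => isEmptyElim x,
        fun a => a.inductionOn fun x => isEmptyElim x⟩
    · obtain ⟨x, hx⟩ := hV.nonempty
      exact PalaisFinite.pathComponentsMap_bijective _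
        (PalaisFinite.uInftyPt x.2 hx) (hbij 0 (PalaisFinite.uInftyPt x.2 hx))
  · intro a b hab
    -- By directedness both classes are represented in one slice `F`; merging in a larger `G` is
    -- equality in the limit.
    induction a, b using DirectLimit.induction₂ with
    | ih F a b =>
      obtain ⟨G, h, hG⟩ := PalaisFinite.exists_piMap_sliceMap_eq hU' hV 0 hpU F a b hab
      exact Quotient.sound ⟨G, h, h, hG⟩
  · intro a
    obtain ⟨F, b, hb⟩ := PalaisFinite.exists_piMap_sliceIncl_eq hU' hV 0 hpU hpV a
    exact ⟨Quotient.mk _ ⟨F, b⟩, hb⟩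
  · intro a b hab
    induction a, b using DirectLimit.induction₂ with
    | ih F a b =>
      obtain ⟨G, h, hG⟩ := PalaisFinite.exists_piMap_sliceMap_eq hU' hV (k + 1) hpU F a b hab
      exact Quotient.sound ⟨G, h, h, hG⟩
  · intro a
    obtain ⟨F, b, hb⟩ := PalaisFinite.exists_piMap_sliceIncl_eq hU' hV (k + 1) hpU hpV a
    exact ⟨Quotient.mk _ ⟨F, b⟩, hb⟩
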